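/- For a permutation $\pi$ of size $k$ and a permutation $\tau$ of size $m$, the skew sum $\pi\ominus\tau$ is the permutation of size $k+m$ with $(\pi\ominus\tau)(i)=\pi(i)+m$ for $1\le i\le k$ and $(\pi\ominus\tau)(k+i)=\tau(i)$ for $1\le i\le m$. A permutation is skew-indecomposable if it is not of the form $\pi\ominus\tau$ with $\pi$ and $\tau$ nonempty. Let $a_{n,\ell}$ be the number of skew-indecomposable permutations $\sigma$ of size $n$ that avoid both patterns $1324$ and $1423$ and satisfy $\sigma(\ell)=1$. Then $a_{1,1}=1$, $a_{2,1}=1$, and for all $n\ge 3$ and $1\le \ell\le n-1$, $$a_{n,\ell} = 2a_{n-1,\ell} + \sum_{j=1}^{\ell-1} a_{n-1,j}.$$ Moreover, the generating function $g(x,u)=\sum_{n=1}^{\infty}\sum_{\ell=1}^{n} a_{n,\ell}\,u^{\ell}x^{n}$ satisfies, in the ring of formal power series $\mathbb{Q}[[x,u]]$, $$g(x,u) = \frac{ux\left[4u-3+4x-3ux-\sqrt{1-6ux+u^2x^2}\right]}{4\left(u-1-ux+2x\right)},$$ where $\sqrt{1-6ux+u^2x^2}$ denotes the unique formal power series with constant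 term $1$ whose square is $1-6ux+u^2x^2$. -/

import Mathlib

open Equiv

namespace SkewAvoid

/-- The skew sum `π ⊖ τ` of a permutation `π` of size `k` and a permutation `τ` of size `m`
(permutations in one-line notation, positions and values counted from `0`): the first `k` entries
are those of `π` raised by `m`, the last `m` entries are those of `τ`. -/
def skewSum {k m : ℕ} (π : Perm (Fin k)) (τ : Perm (Fin m)) : Perm (Fin (k + m)) :=
  finSumFinEquiv.symm.trans <|
    (Equiv.sumCongr π τ).trans <|
      (Equiv.sumComm (Fin k) (Fin m)).trans <|
        finSumFinEquiv.trans (finCongr (Nat.add_comm m k))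

theorem skewSum_castAdd {k m : ℕ} (π : Perm (Fin k)) (τ : Perm (Fin m)) (i : Fin k) :
    (skewSum π τ (Fin.castAdd m i) : ℕ) = (π i : ℕ) + m := by
  simp [skewSum]

theorem skewSum_natAdd {k m : ℕ} (π : Perm (Fin k)) (τ : Perm (Fin m)) (i : Fin m) :
    (skewSum π τ (Fin.natAdd k i) : ℕ) = (τ i : ℕ) := by
  simp [skewSum]

/-- `σ` is the skew sum of two nonempty permutations. -/
def SkewDecomposable {n : ℕ} (σ : Perm (Fin n)) : Prop :=
  ∃ (k m : ℕ) (h : k + m = n), 0 < k ∧ 0 < m ∧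
    ∃ (π : Perm (Fin k)) (τ : Perm (Fin m)), σ = (finCongr h).permCongr (skewSum π τ)

def SkewIndecomposable {n : ℕ} (σ : Perm (Fin n)) : Prop :=
  ¬ SkewDecomposable σ

/-- `σ` contains the pattern `p`: some subsequence of `σ`, at the positions
`f 0 < f 1 < ⋯`, is order isomorphic to `p`. -/
def Contains {n k : ℕ} (σ : Perm (Fin n)) (p : Perm (Fin k)) : Prop :=
  ∃ f : Fin k ↪o Fin n, ∀ i j : Fin k, σ (f i) < σ (f j) ↔ p i < p j

def Avoids {n k : ℕ} (σ : Perm (Fin n)) (p : Perm (Fin k)) : Prop :=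
  ¬ Contains σ p

/-- The pattern `1324` (written `0213` when values are counted from `0`). -/
def pat1324 : Perm (Fin 4) where
  toFun := ![0, 2, 1, 3]
  invFun := ![0, 2, 1, 3]
  left_inv := by decide
  right_inv := by decide

/-- The pattern `1423` (written `0312` when values are counted from `0`). -/
def pat1423 : Perm (Fin 4) where
  toFun := ![0, 3, 1, 2]
  invFun := ![0, 2, 3, 1]
  left_inv := by decide
  right_inv := by decide

/-- The skew-indecomposable `(1324,1423)`-avoiding permutations of size `n` with entry `1` at
position `ℓ`. Here `n` and `ℓ` are the usual size and position, counted from `1`; the `i`-th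
element of `Fin n` stands for position, or value, `i + 1`. -/
def avoiders (n ℓ : ℕ) : Set (Perm (Fin n)) :=
  {σ | Avoids σ pat1324 ∧ Avoids σ pat1423 ∧ SkewIndecomposable σ ∧
    ∃ i : Fin n, (i : ℕ) + 1 = ℓ ∧ (σ i : ℕ) + 1 = 1}

/-- The number `a_{n,ℓ}`. -/
noncomputable def a (n ℓ : ℕ) : ℕ :=
  (avoiders n ℓ).ncard

/-- The numbers `a n ℓ` vanish outside the range `1 ≤ ℓ ≤ n`. -/
theorem a_eq_zero {n ℓ : ℕ} (h : ¬ (1 ≤ ℓ ∧ ℓ ≤ n)) : a n ℓ = 0 := by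
  have : avoiders n ℓ = ∅ := by
    ext σ
    simp only [avoiders, Set.mem_ofPred_eq, Set.mem_empty_iff_false, iff_false]
    rintro ⟨-, -, -, i, hi, -⟩
    have := i.isLt
    omega
  rw [a, this, Set.ncard_empty]

/-- The formal variable `x` (marking the size), in `ℚ⟦x, u⟧`. -/
noncomputable def x : MvPowerSeries (Fin 2) ℚ := MvPowerSeries.X 0

/-- The formal variable `u` (marking the position of `1`), in `ℚ⟦x, u⟧`. -/
noncomputable def u : MvPowerSeries (Fin 2) ℚ := MvPowerSeries.X 1

/-- The generating function `∑_{n ≥ 1} ∑_{1 ≤ ℓ ≤ n} a_{n,ℓ} u^ℓ x^n` in `ℚ⟦x, u⟧`: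
the coefficient of `x ^ d 0 * u ^ d 1` is `a (d 0) (d 1)` if `1 ≤ d 1 ≤ d 0`, and `0` otherwise. -/
noncomputable def g : MvPowerSeries (Fin 2) ℚ :=
  fun d => if 1 ≤ d 1 ∧ d 1 ≤ d 0 then (a (d 0) (d 1) : ℚ) else 0

/-- `S` is the formal square root of `F`, the one with constant term `1`. -/
def IsFormalSqrt (F S : MvPowerSeries (Fin 2) ℚ) : Prop :=
  S ^ 2 = F ∧ MvPowerSeries.constantCoeff S = 1

/-- The denominator `4 (u - 1 - u x + 2 x)` has a nonzero constant term, so that its inverse in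
`ℚ⟦x, u⟧` is a true inverse. -/
theorem denominator_mul_inv :
    (4 * (u - 1 - u * x + 2 * x)) * (4 * (u - 1 - u * x + 2 * x))⁻¹ = 1 := by
  apply MvPowerSeries.mul_inv_cancel
  have h4 : MvPowerSeries.constantCoeff (4 : MvPowerSeries (Fin 2) ℚ) = 4 :=
    map_ofNat _ 4
  simp [u, x, h4]

end SkewAvoid

open SkewAvoid

namespace SkewAvoid

/-! Together the two patterns forbid a valley: a subsequence `a y b z` with `a` below `b` and `b`
below both `y` and `z`. With values counted from 0, the recurrence comes from the position of the
value 1. If 1 stands to the right of 0 with an entry between them and an entry after it, then 0, the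
entry after 0, the value 1 and the last entry form a valley. So 1 is directly after 0 or at the very
end, and deleting it gives two copies of the avoiders of size `n` with the same position of 0. If 1
stands to the left of 0, deleting 0 makes 1 the minimum, which gives the sum over earlier positions.
Both deletions are reversible and preserve skew-indecomposability, because a cut never lies to the
right of the minimum (`avoiders_succ`, `a_succ`).

For the generating function, differencing in the position removes the sum and leaves a triangle
determined by its boundary (`IsTriangle.unique`). It remains to find a series `H` with the same
triangle (`isTriangle_closedForm`). The kernel is `K = u - 1 - u * x + 2 * x`, and `G = (1 + u * x -
S) / 4` is a root of `P(t) = 2 * t ^ 2 - (1 + u * x) * t + u * x`. Since `P(x) = x * K`, `K` divides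
`G - x` with an explicit cofactor. This makes the support of `H` visible, and the boundary zeros
follow from it. -/

/-! ### Valleys and skew cuts. -/

/-- `σ` has no subsequence `a y b z` with `a < b` and `b < y, z`. -/
def ValleyFree {n : ℕ} (σ : Perm (Fin n)) : Prop :=
  ∀ i j k m : Fin n, i < j → j < k → k < m → σ i < σ k → σ k < σ j → σ k < σ m → False

/-- Some proper nonempty prefix of `σ` lies entirely above the rest. -/
def HasSkewCut {n : ℕ} (σ : Perm (Fin n)) : Prop :=
  ∃ c : ℕ, 0 < c ∧ c < n ∧ ∀ i j : Fin n, (i : ℕ) < c → c ≤ (j : ℕ) → σ j < σ i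

theorem strictMono_of_lt_four {n : ℕ} {i j k m : Fin n} (hij : i < j) (hjk : j < k)
    (hkm : k < m) : StrictMono ![i, j, k, m] := by
  rw [Fin.strictMono_iff_lt_succ]
  intro t
  fin_cases t
  · exact hij
  · exact hjk
  · exact hkm

/-- In a valley `a y b z` only the order of `y` and `z` is free, and it decides between the two
patterns. -/
theorem valleyFree_iff {n : ℕ} (σ : Perm (Fin n)) :
    ValleyFree σ ↔ Avoids σ pat1324 ∧ Avoids σ pat1423 := by
  constructor
  · intro h
    constructor
    · rintro ⟨f, hf⟩
      exact h (f 0) (f 1) (f 2) (f 3) (f.strictMono (by decide)) (f.strictMono (by decide))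
        (f.strictMono (by decide)) ((hf 0 2).2 (by decide)) ((hf 2 1).2 (by decide))
        ((hf 2 3).2 (by decide))
    · rintro ⟨f, hf⟩
      exact h (f 0) (f 1) (f 2) (f 3) (f.strictMono (by decide)) (f.strictMono (by decide))
        (f.strictMono (by decide)) ((hf 0 2).2 (by decide)) ((hf 2 1).2 (by decide))
        ((hf 2 3).2 (by decide))
  · rintro ⟨h₁, h₂⟩ i j k m hij hjk hkm hik hkj hkm'
    have hjm : σ j ≠ σ m := fun e => (hjk.trans hkm).ne (σ.injective e)
    rcases lt_or_gt_of_ne hjm with hlt | hgt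
    · refine h₁ ⟨OrderEmbedding.ofStrictMono _ (strictMono_of_lt_four hij hjk hkm), ?_⟩
      intro s t
      fin_cases s <;> fin_cases t <;> simp [pat1324] <;> order
    · refine h₂ ⟨OrderEmbedding.ofStrictMono _ (strictMono_of_lt_four hij hjk hkm), ?_⟩
      intro s t
      fin_cases s <;> fin_cases t <;> simp [pat1423] <;> order

theorem HasSkewCut.of_skewDecomposable {n : ℕ} {σ : Perm (Fin n)} (h : SkewDecomposable σ) :
    HasSkewCut σ := by
  obtain ⟨k, m, rfl, hk, hm, π, τ, rfl⟩ := h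
  refine ⟨k, hk, by omega, fun i j hi hj => ?_⟩
  have e₁ : i = Fin.castAdd m ⟨i, hi⟩ := rfl
  have e₂ : j = Fin.natAdd k ⟨j - k, by omega⟩ := by ext; simp; omega
  have h₁ := skewSum_castAdd π τ ⟨i, hi⟩
  have h₂ := skewSum_natAdd π τ ⟨j - k, by omega⟩
  rw [← e₁] at h₁
  rw [← e₂] at h₂
  have : (skewSum π τ j : ℕ) < (skewSum π τ i : ℕ) := by
    rw [h₁, h₂]
    omega
  exact this

/-- By counting: each suffix value has the `k` prefix values above it, hence is below `m`; each
prefix value has the `m` suffix values below it. -/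
theorem HasSkewCut.skewDecomposable {n : ℕ} {σ : Perm (Fin n)} (h : HasSkewCut σ) :
    SkewDecomposable σ := by
  obtain ⟨k, hk, hkn, hcut⟩ := h
  obtain ⟨m, rfl⟩ : ∃ m, n = k + m := ⟨n - k, by omega⟩
  have hlow : ∀ j : Fin m, (σ (Fin.natAdd k j) : ℕ) < m := by
    intro j
    have hsub : (Finset.univ.map (Fin.castAddEmb m)).map σ.toEmbedding ⊆
        Finset.Ioi (σ (Fin.natAdd k j)) := by
      intro y hy
      simp only [Finset.mem_map, Finset.mem_univ, true_and] at hy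
      obtain ⟨_, ⟨i, rfl⟩, rfl⟩ := hy
      exact Finset.mem_Ioi.2 (hcut _ _ (by simp) (by simp))
    have := Finset.card_le_card hsub
    simp only [Finset.card_map, Finset.card_univ, Fintype.card_fin, Fin.card_Ioi] at this
    omega
  have hhigh : ∀ i : Fin k, m ≤ (σ (Fin.castAdd m i) : ℕ) := by
    intro i
    have hsub : (Finset.univ.map (Fin.natAddEmb (m := m) k)).map σ.toEmbedding ⊆
        Finset.Iio (σ (Fin.castAdd m i)) := by
      intro y hy
      simp only [Finset.mem_map, Finset.mem_univ, true_and] at hy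
      obtain ⟨_, ⟨j, rfl⟩, rfl⟩ := hy
      exact Finset.mem_Iio.2 (hcut _ _ (by simp) (by simp))
    have := Finset.card_le_card hsub
    simpa only [Finset.card_map, Finset.card_univ, Fintype.card_fin, Fin.card_Iio] using this
  let p : Fin k → Fin k := fun i => ⟨σ (Fin.castAdd m i) - m, by omega⟩
  let t : Fin m → Fin m := fun j => ⟨σ (Fin.natAdd k j), hlow j⟩
  have hp : p.Injective := by
    intro i j hij
    have h₁ := hhigh i
    have h₂ := hhigh j
    have h₃ : (σ (Fin.castAdd m i) : ℕ) - m = σ (Fin.castAdd m j) - m := congrArg Fin.val hij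
    have h₄ : σ (Fin.castAdd m i) = σ (Fin.castAdd m j) := by ext; omega
    simpa using h₄
  have ht : t.Injective := by
    intro i j hij
    have h₃ : (σ (Fin.natAdd k i) : ℕ) = σ (Fin.natAdd k j) := by
      simpa [t] using hij
    have h₄ := Fin.ext h₃
    simpa using h₄
  refine ⟨k, m, rfl, hk, by omega, Equiv.ofBijective p (Finite.injective_iff_bijective.1 hp),
    Equiv.ofBijective t (Finite.injective_iff_bijective.1 ht), ?_⟩
  ext i
  change (σ i : ℕ) = skewSum _ _ i
  induction i using Fin.addCases with
  | left i =>
    rw [skewSum_castAdd]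
    change _ = (σ (Fin.castAdd m i) : ℕ) - m + m
    have := hhigh i
    omega
  | right j =>
    rw [skewSum_natAdd]
    rfl

theorem hasSkewCut_iff {n : ℕ} (σ : Perm (Fin n)) : HasSkewCut σ ↔ SkewDecomposable σ :=
  ⟨HasSkewCut.skewDecomposable, HasSkewCut.of_skewDecomposable⟩

theorem mem_avoiders_iff {n z : ℕ} {σ : Perm (Fin n)} :
    σ ∈ avoiders n (z + 1) ↔
      ValleyFree σ ∧ ¬ HasSkewCut σ ∧ ∃ i : Fin n, (i : ℕ) = z ∧ (σ i : ℕ) = 0 := by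
  simp only [avoiders, Set.mem_ofPred_eq, valleyFree_iff, hasSkewCut_iff, SkewIndecomposable,
    and_assoc, add_left_inj, Nat.add_eq_right]

/-! ### Inserting and deleting a small value. -/

/-- Insert the value `v` at position `p`. -/
def insertAt {n : ℕ} (p v : Fin (n + 1)) (σ : Perm (Fin n)) : Perm (Fin (n + 1)) :=
  (finSuccEquiv' p).trans ((optionCongr σ).trans (finSuccEquiv' v).symm)

@[simp] theorem insertAt_self {n : ℕ} (p v : Fin (n + 1)) (σ : Perm (Fin n)) :
    insertAt p v σ p = v := by
  simp [insertAt]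

@[simp] theorem insertAt_succAbove {n : ℕ} (p v : Fin (n + 1)) (σ : Perm (Fin n)) (i : Fin n) :
    insertAt p v σ (p.succAbove i) = v.succAbove (σ i) := by
  simp [insertAt]

theorem insertAt_injective {n : ℕ} (p v : Fin (n + 1)) :
    Function.Injective (insertAt p v) := by
  intro σ τ h
  ext i : 1
  have := congrArg (fun ρ : Perm (Fin (n + 1)) => ρ (p.succAbove i)) h
  simpa using this

theorem exists_eq_insertAt {n : ℕ} {p v : Fin (n + 1)} {σ : Perm (Fin (n + 1))} (h : σ p = v) :
    ∃ τ, σ = insertAt p v τ := by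
  let e : Option (Fin n) ≃ Option (Fin n) :=
    (finSuccEquiv' p).symm.trans (σ.trans (finSuccEquiv' v))
  have he : e none = none := by simp [e, h]
  refine ⟨removeNone e, ?_⟩
  have h₂ : optionCongr (removeNone e) = e := by
    ext1 i
    cases i with
    | none => simp [he]
    | some i =>
      obtain ⟨y, hy⟩ : ∃ y, e (some i) = some y := by
        rw [← Option.ne_none_iff_exists', ← he]
        exact fun hh => by simpa using e.injective hh
      rw [optionCongr_apply, Option.map_some, removeNone_some e ⟨y, hy⟩]
  rw [insertAt, h₂]
  ext i
  simp [e]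

theorem val_le_val_succAbove {n : ℕ} (p : Fin (n + 1)) (i : Fin n) :
    (i : ℕ) ≤ p.succAbove i := by
  rcases lt_or_ge i.castSucc p with h | h
  · rw [Fin.succAbove_of_castSucc_lt _ _ h, Fin.val_castSucc]
  · rw [Fin.succAbove_of_le_castSucc _ _ h, Fin.val_succ]
    omega

section InsertAt

variable {n : ℕ} {p v : Fin (n + 1)} {σ : Perm (Fin n)}

theorem insertAt_lt_insertAt_iff {i j : Fin n} :
    insertAt p v σ (p.succAbove i) < insertAt p v σ (p.succAbove j) ↔ σ i < σ j := by
  simp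

theorem ValleyFree.of_insertAt (h : ValleyFree (insertAt p v σ)) : ValleyFree σ := by
  intro i j k m hij hjk hkm h₁ h₂ h₃
  exact h (p.succAbove i) (p.succAbove j) (p.succAbove k) (p.succAbove m)
    (by simpa using hij) (by simpa using hjk) (by simpa using hkm)
    (by simpa using h₁) (by simpa using h₂) (by simpa using h₃)

/-- Inserting the new minimum, or the new second smallest value, to the right of the minimum
creates no valley, as long as in the second case it goes directly after the minimum or to the
very end. -/
theorem ValleyFree.insertAt {z : Fin n} (h : ValleyFree σ) (hz : (σ z : ℕ) = 0)
    (hzp : (z : ℕ) < p) (hv : (v : ℕ) ≤ 1)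
    (hp : (v : ℕ) = 1 → (p : ℕ) = z + 1 ∨ (p : ℕ) = n) : ValleyFree (insertAt p v σ) := by
  intro i j k m hij hjk hkm h₁ h₂ h₃
  have hzc : p.succAbove z = z.castSucc := Fin.succAbove_of_castSucc_lt _ _ hzp
  have hj : j ≠ p := by
    rintro rfl
    rw [insertAt_self] at h₂
    omega
  have hm : m ≠ p := by
    rintro rfl
    rw [insertAt_self] at h₃
    omega
  -- As the low point `b`, the new entry must be 1 and `a` must be the old minimum; then there is no
  -- room for `y` before it or none for `z` after it.
  have hk : k ≠ p := by
    rintro rfl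
    rw [insertAt_self] at h₁
    have hi : i ≠ k := (hij.trans hjk).ne
    obtain ⟨i, rfl⟩ := Fin.exists_succAbove_eq hi
    rw [insertAt_succAbove] at h₁
    have hi0 : (σ i : ℕ) = 0 := by
      rcases lt_or_ge (σ i).castSucc v with hl | hl
      · have : (σ i : ℕ) < v := hl
        omega
      · rw [Fin.succAbove_of_le_castSucc _ _ hl] at h₁
        have h₅ : (σ i : ℕ) + 1 < v := h₁
        omega
    have hiz : i = z := σ.injective (Fin.ext (hi0.trans hz.symm))
    subst hiz
    rw [hzc] at hij
    have h₆ : (i : ℕ) < j := hij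
    have h₇ : (v : ℕ) = 1 := by omega
    have := hp h₇
    omega
  obtain ⟨j, rfl⟩ := Fin.exists_succAbove_eq hj
  obtain ⟨k, rfl⟩ := Fin.exists_succAbove_eq hk
  obtain ⟨m, rfl⟩ := Fin.exists_succAbove_eq hm
  rw [insertAt_lt_insertAt_iff] at h₂ h₃
  rw [Fin.succAbove_lt_succAbove_iff] at hjk hkm
  by_cases hi : i = p
  -- The old minimum, which lies further left, can replace the new entry in the role of `a`.
  · subst hi
    have hzj : z < j := by
      rw [← Fin.succAbove_lt_succAbove_iff (p := i), hzc]
      exact lt_trans hzp hij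
    have hne : (σ k : ℕ) ≠ 0 := fun h0 =>
      (hzj.trans hjk).ne (σ.injective (Fin.ext (hz.trans h0.symm)))
    exact h z j k m hzj hjk hkm (Fin.lt_def.2 (by omega)) h₂ h₃
  · obtain ⟨i, rfl⟩ := Fin.exists_succAbove_eq hi
    rw [insertAt_lt_insertAt_iff] at h₁
    rw [Fin.succAbove_lt_succAbove_iff] at hij
    exact h i j k m hij hjk hkm h₁ h₂ h₃

/-- A cut lies at or before the minimum, so an entry inserted to the right of the minimum does not
move it, and a value at most 1 stays below the prefix. The exception, excluded by `hp`, is a new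
minimum at the very end, which always creates a cut. -/
theorem hasSkewCut_insertAt_iff {z : Fin n} (hz : (σ z : ℕ) = 0)
    (hzp : (z : ℕ) < p) (hv : (v : ℕ) ≤ 1) (hp : (v : ℕ) = 0 → (p : ℕ) ≠ n) :
    HasSkewCut (insertAt p v σ) ↔ HasSkewCut σ := by
  have hzc : p.succAbove z = z.castSucc := Fin.succAbove_of_castSucc_lt _ _ hzp
  constructor
  · rintro ⟨c, hc, hcn, hcut⟩
    have hcz : c ≤ z := by
      by_contra! hzlt
      have h₁ := hcut (p.succAbove z) (Fin.last n) (by rw [hzc]; exact hzlt) (by simp; omega)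
      rw [insertAt_succAbove] at h₁
      have hz0 : v = 0 ∨ v.succAbove (σ z) = 0 := by
        rcases eq_or_ne v 0 with hv0 | hv0
        · exact Or.inl hv0
        · right
          have hv0' : (v : ℕ) ≠ 0 := fun h => hv0 (Fin.ext h)
          rw [Fin.succAbove_of_castSucc_lt _ _ (Fin.lt_def.2 (by simp; omega))]
          exact Fin.ext hz
      rcases hz0 with rfl | h0
      · rw [Fin.succAbove_zero] at h₁
        have h₂ : (insertAt p 0 σ (Fin.last n) : ℕ) < σ z + 1 := h₁
        have h₃ : insertAt p 0 σ (Fin.last n) = insertAt p 0 σ p := by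
          refine Fin.ext ?_
          rw [insertAt_self, Fin.val_zero]
          omega
        have h₄ := (insertAt p 0 σ).injective h₃
        apply hp rfl
        rw [← h₄]
        rfl
      · rw [h0] at h₁
        exact absurd h₁ (Fin.not_lt_zero _)
    refine ⟨c, hc, by omega, fun i j hi hj => ?_⟩
    rw [← insertAt_lt_insertAt_iff (p := p) (v := v)]
    refine hcut _ _ ?_ ?_
    · rw [Fin.succAbove_of_castSucc_lt _ _ (Fin.lt_def.2 (by simp; omega))]
      exact hi
    · exact hj.trans (val_le_val_succAbove p j)
  · rintro ⟨c, hc, hcn, hcut⟩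
    have hcz : c ≤ z := by
      by_contra! hzlt
      have := Fin.lt_def.1 (hcut z ⟨c, hcn⟩ hzlt le_rfl)
      omega
    refine ⟨c, hc, by omega, fun i j hi hj => ?_⟩
    have hip : i ≠ p := by
      rintro rfl
      omega
    obtain ⟨i, rfl⟩ := Fin.exists_succAbove_eq hip
    have hi' : (i : ℕ) < c := lt_of_le_of_lt (val_le_val_succAbove p i) hi
    by_cases hj' : j = p
    · subst hj'
      have h₁ := Fin.lt_def.1 (hcut i z hi' hcz)
      rw [insertAt_self, insertAt_succAbove,
        Fin.succAbove_of_le_castSucc _ _ (Fin.le_def.2 (by simp; omega)), Fin.lt_def]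
      simp
      omega
    · obtain ⟨j, rfl⟩ := Fin.exists_succAbove_eq hj'
      rw [insertAt_lt_insertAt_iff]
      refine hcut i j hi' ?_
      rcases lt_or_ge j.castSucc p with hl | hl
      · rwa [Fin.succAbove_of_castSucc_lt _ _ hl] at hj
      · have : (p : ℕ) ≤ j := hl
        omega

end InsertAt

theorem insertAt_mem_avoiders {n z : ℕ} {p v : Fin (n + 1)} {τ : Perm (Fin n)} {i : Fin n}
    (hτ : τ ∈ avoiders n ((i : ℕ) + 1)) (hip : (i : ℕ) < p) (hv : (v : ℕ) ≤ 1)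
    (h₁ : (v : ℕ) = 1 → (p : ℕ) = i + 1 ∨ (p : ℕ) = n) (h₀ : (v : ℕ) = 0 → (p : ℕ) ≠ n)
    (hz : z = if (v : ℕ) = 0 then (p : ℕ) else i) :
    insertAt p v τ ∈ avoiders (n + 1) (z + 1) := by
  rw [mem_avoiders_iff] at hτ ⊢
  obtain ⟨hfree, hcut, i', hi', hi0⟩ := hτ
  obtain rfl : i' = i := Fin.ext hi'
  refine ⟨hfree.insertAt hi0 hip hv h₁, fun h => hcut ((hasSkewCut_insertAt_iff hi0 hip hv h₀).1 h),
    ?_⟩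
  split_ifs at hz with hv0
  · exact ⟨p, hz.symm, by rw [insertAt_self, hv0]⟩
  · refine ⟨p.succAbove i', ?_, ?_⟩
    · rw [Fin.succAbove_of_castSucc_lt _ _ (Fin.lt_def.2 hip), hz, Fin.val_castSucc]
    · rw [insertAt_succAbove, Fin.succAbove_of_castSucc_lt _ _ (Fin.lt_def.2 (by simp; omega)),
        Fin.val_castSucc, hi0]

theorem mem_avoiders_of_insertAt {n z : ℕ} {p v : Fin (n + 1)} {τ : Perm (Fin n)} {i : Fin n}
    (hτ : insertAt p v τ ∈ avoiders (n + 1) (z + 1)) (hi0 : (τ i : ℕ) = 0) (hip : (i : ℕ) < p)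
    (hv : (v : ℕ) ≤ 1) (h₀ : (v : ℕ) = 0 → (p : ℕ) ≠ n) :
    τ ∈ avoiders n ((i : ℕ) + 1) := by
  rw [mem_avoiders_iff] at hτ ⊢
  exact ⟨hτ.1.of_insertAt, fun h => hτ.2.1 ((hasSkewCut_insertAt_iff hi0 hip hv h₀).2 h),
    i, rfl, hi0⟩

/-! ### The recurrence. -/

theorem eq_of_mem_avoiders {n ℓ ℓ' : ℕ} {σ : Perm (Fin n)} (h : σ ∈ avoiders n ℓ)
    (h' : σ ∈ avoiders n ℓ') : ℓ = ℓ' := by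
  obtain ⟨-, -, -, i, hi, hσ⟩ := h
  obtain ⟨-, -, -, j, hj, hσ'⟩ := h'
  have : i = j := σ.injective (Fin.ext (by omega))
  rw [← hi, ← hj, this]

/-- A skew-indecomposable permutation of size at least `2` does not end in its minimum. -/
theorem avoiders_self_eq_empty {n : ℕ} (hn : 2 ≤ n) : avoiders n n = ∅ := by
  obtain ⟨m, rfl⟩ : ∃ m, n = m + 1 := ⟨n - 1, by omega⟩
  refine Set.eq_empty_of_forall_notMem fun σ hσ => ?_
  obtain ⟨-, hcut, i, hi, hi0⟩ := mem_avoiders_iff.1 hσ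
  refine hcut ⟨m, by omega, by omega, fun s t hs ht => ?_⟩
  obtain rfl : t = i := Fin.ext (by omega)
  have : (σ s : ℕ) ≠ 0 := fun h => by
    have := σ.injective (Fin.ext (h.trans hi0.symm))
    omega
  exact Fin.lt_def.2 (by omega)

theorem a_self {n : ℕ} (hn : 2 ≤ n) : a n n = 0 := by
  rw [a, avoiders_self_eq_empty hn, Set.ncard_empty]

/-- The three images correspond to the value 1 directly after the minimum, at the very end, or to
the left of the minimum. -/
theorem avoiders_succ {n z : ℕ} (hn : 2 ≤ n) (hz : z < n) :
    avoiders (n + 1) (z + 1) =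
      (insertAt ⟨z + 1, by omega⟩ ⟨1, by omega⟩ '' avoiders n (z + 1) ∪
        insertAt (Fin.last n) ⟨1, by omega⟩ '' avoiders n (z + 1)) ∪
      insertAt ⟨z, by omega⟩ 0 '' ⋃ j ∈ Finset.Icc 1 z, avoiders n j := by
  have hn1 : 1 < n + 1 := by omega
  apply Set.Subset.antisymm
  · intro σ hσ
    obtain ⟨hfree, hcut, i, hi, hi0⟩ := mem_avoiders_iff.1 hσ
    obtain ⟨q, hq⟩ := σ.surjective ⟨1, hn1⟩
    have hq1 : (σ q : ℕ) = 1 := by rw [hq]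
    have hqi : q ≠ i := by
      rintro rfl
      omega
    rcases lt_or_gt_of_ne hqi with hlt | hgt
    · right
      have hiz : i = ⟨z, by omega⟩ := Fin.ext hi
      obtain ⟨τ, rfl⟩ := exists_eq_insertAt (p := i) (v := 0) (Fin.ext hi0)
      obtain ⟨q, rfl⟩ := Fin.exists_succAbove_eq hqi
      have hqi' : (q : ℕ) < i := lt_of_le_of_lt (val_le_val_succAbove i q) hlt
      rw [insertAt_succAbove, Fin.succAbove_zero, Fin.val_succ] at hq1
      refine ⟨τ, Set.mem_iUnion₂.2 ⟨(q : ℕ) + 1, Finset.mem_Icc.2 ⟨by omega, by omega⟩,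
        mem_avoiders_of_insertAt hσ (by omega) hqi' (by simp) (by omega)⟩, by rw [hiz]⟩
    · left
      -- Otherwise the minimum, its right neighbour, the value 1 and the last entry form a valley.
      have hq' : (q : ℕ) = z + 1 ∨ (q : ℕ) = n := by
        by_contra! hne
        have h₁ : (i : ℕ) < q := hgt
        have hbig : ∀ t : Fin (n + 1), t ≠ i → t ≠ q → 1 < (σ t : ℕ) := by
          intro t hti htq
          have h₂ : (σ t : ℕ) ≠ 0 := fun h => hti (σ.injective (Fin.ext (h.trans hi0.symm)))
          have h₃ : (σ t : ℕ) ≠ 1 := fun h => htq (σ.injective (Fin.ext (h.trans hq1.symm)))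
          omega
        have h₂ := hbig ⟨z + 1, by omega⟩ (fun h => by simp [Fin.ext_iff] at h; omega)
          (fun h => by simp [Fin.ext_iff] at h; omega)
        have h₃ := hbig (Fin.last n) (fun h => by simp [Fin.ext_iff] at h; omega)
          (fun h => by simp [Fin.ext_iff] at h; omega)
        exact hfree i ⟨z + 1, by omega⟩ q (Fin.last n) (Fin.lt_def.2 (by simp; omega))
          (Fin.lt_def.2 (by simp; omega)) (Fin.lt_def.2 (by simp; omega))
          (Fin.lt_def.2 (by omega)) (Fin.lt_def.2 (by omega)) (Fin.lt_def.2 (by omega))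
      obtain ⟨τ, rfl⟩ := exists_eq_insertAt hq
      obtain ⟨i, rfl⟩ := Fin.exists_succAbove_eq hqi.symm
      have hiq : (i : ℕ) < q := lt_of_le_of_lt (val_le_val_succAbove q i) hgt
      rw [Fin.succAbove_of_castSucc_lt _ _ (Fin.lt_def.2 hiq), Fin.val_castSucc] at hi
      have hτ0 : (τ i : ℕ) = 0 := by
        have h₁ := val_le_val_succAbove ⟨1, by omega⟩ (τ i)
        rw [insertAt_succAbove] at hi0
        omega
      have hτ := mem_avoiders_of_insertAt hσ hτ0 hiq (by simp) (by simp)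
      rw [hi] at hτ
      rcases hq' with hq' | hq'
      · have hqe : q = ⟨z + 1, by omega⟩ := Fin.ext hq'
        exact Or.inl ⟨τ, hτ, by rw [hqe]⟩
      · have hqe : q = Fin.last n := Fin.ext hq'
        exact Or.inr ⟨τ, hτ, by rw [hqe]⟩
  · rintro _ ((⟨τ, hτ, rfl⟩ | ⟨τ, hτ, rfl⟩) | ⟨τ, hτ, rfl⟩)
    · exact insertAt_mem_avoiders (i := ⟨z, hz⟩) hτ (by simp) (by simp) (by simp) (by simp)
        (by simp)
    · exact insertAt_mem_avoiders (i := ⟨z, hz⟩) hτ (by simpa) (by simp) (by simp) (by simp)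
        (by simp)
    · obtain ⟨j, hj, hτ⟩ := Set.mem_iUnion₂.1 hτ
      rw [Finset.mem_Icc] at hj
      obtain ⟨j, rfl⟩ : ∃ k, j = k + 1 := ⟨j - 1, by omega⟩
      exact insertAt_mem_avoiders (i := ⟨j, by omega⟩) hτ (by simp; omega) (by simp) (by simp)
        (by simp; omega) (by simp)

theorem a_succ {n z : ℕ} (hn : 2 ≤ n) (hz : z < n) :
    a (n + 1) (z + 1) = 2 * a n (z + 1) + ∑ j ∈ Finset.Icc 1 z, a n j := by
  have hempty := avoiders_self_eq_empty hn
  rw [a, avoiders_succ hn hz, Set.ncard_union_eq _ (Set.toFinite _) (Set.toFinite _),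
    Set.ncard_union_eq _ (Set.toFinite _) (Set.toFinite _),
    Set.ncard_image_of_injective _ (insertAt_injective _ _),
    Set.ncard_image_of_injective _ (insertAt_injective _ _),
    Set.ncard_image_of_injective _ (insertAt_injective _ _), ← two_mul]
  · congr 1
    have := Set.Finite.ncard_biUnion (Finset.finite_toSet (Finset.Icc 1 z)) (s := avoiders n)
      (fun _ _ => Set.toFinite _)
      (fun i _ j _ hij => Set.disjoint_left.2 fun σ h h' => hij (eq_of_mem_avoiders h h'))
    rw [finsum_mem_coe_finset] at this
    exact this
  · refine Set.disjoint_left.2 ?_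
    rintro _ ⟨τ, hτ, rfl⟩ ⟨τ', hτ', he⟩
    have h₁ : insertAt ⟨z + 1, by omega⟩ ⟨1, by omega⟩ τ ⟨z + 1, by omega⟩ = ⟨1, by omega⟩ :=
      insertAt_self _ _ _
    have h₂ : insertAt (Fin.last n) ⟨1, by omega⟩ τ' (Fin.last n) = ⟨1, by omega⟩ :=
      insertAt_self _ _ _
    rw [he] at h₂
    have h₃ := Equiv.injective _ (h₁.trans h₂.symm)
    -- The two positions of the value 1 coincide only here, and then both families are empty.
    have h₄ : z + 1 = n := congrArg Fin.val h₃
    rw [h₄, hempty] at hτ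
    exact hτ
  · refine Set.disjoint_left.2 ?_
    rintro σ h ⟨τ, hτ, rfl⟩
    obtain ⟨j, hj, hτ⟩ := Set.mem_iUnion₂.1 hτ
    rw [Finset.mem_Icc] at hj
    obtain ⟨j, rfl⟩ : ∃ k, j = k + 1 := ⟨j - 1, by omega⟩
    obtain ⟨-, -, i, hi, hi0⟩ := mem_avoiders_iff.1 hτ
    have h₁ : (insertAt ⟨z, by omega⟩ 0 τ ((⟨z, by omega⟩ : Fin (n + 1)).succAbove i) : ℕ) = 1 := by
      rw [insertAt_succAbove, Fin.succAbove_zero, Fin.val_succ, hi0]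
    have h₂ : (((⟨z, by omega⟩ : Fin (n + 1)).succAbove i : Fin (n + 1)) : ℕ) = i := by
      rw [Fin.succAbove_of_castSucc_lt _ _ (Fin.lt_def.2 (by simp; omega)), Fin.val_castSucc]
    -- In the third family the value 1 stands to the left of position `z`; in the other two it
    -- stands to the right.
    have key : ∀ p : Fin (n + 1), z < p →
        insertAt (⟨z, by omega⟩ : Fin (n + 1)) 0 τ p ≠ ⟨1, by omega⟩ := by
      intro p hp h₃
      have h₄ := Equiv.injective _ (h₃.trans (Fin.ext h₁).symm)
      rw [h₄, h₂] at hp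
      omega
    rcases h with ⟨ρ, -, hρ⟩ | ⟨ρ, -, hρ⟩
    · refine key ⟨z + 1, by omega⟩ (by simp) ?_
      rw [← hρ, insertAt_self]
    · refine key (Fin.last n) (by simpa) ?_
      rw [← hρ, insertAt_self]

theorem mem_avoiders_one_iff {n : ℕ} (hn : n = 1 ∨ n = 2) (σ : Perm (Fin n)) :
    σ ∈ avoiders n 1 ↔ σ = 1 := by
  rw [← zero_add 1, mem_avoiders_iff]
  rcases hn with rfl | rfl
  · refine ⟨fun _ => Subsingleton.elim _ _, fun _ => ⟨?_, ?_, 0, rfl, by simp⟩⟩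
    · intro i j k m hij
      omega
    · rintro ⟨c, hc, hc', -⟩
      omega
  · constructor
    · rintro ⟨-, -, i, hi, hi0⟩
      obtain rfl : i = 0 := Fin.ext hi
      have h0 : σ 0 = 0 := Fin.ext hi0
      revert σ
      decide
    · rintro rfl
      refine ⟨?_, ?_, 0, rfl, rfl⟩
      · intro i j k m hij hjk hkm
        omega
      · rintro ⟨c, hc, hc', h⟩
        have := h 0 1 hc (by simp; omega)
        simp at this

theorem a_one_one : a 1 1 = 1 := by
  rw [a, Set.ncard_eq_one]
  exact ⟨1, Set.ext fun σ => mem_avoiders_one_iff (Or.inl rfl) σ⟩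

theorem a_two_one : a 2 1 = 1 := by
  rw [a, Set.ncard_eq_one]
  exact ⟨1, Set.ext fun σ => mem_avoiders_one_iff (Or.inr rfl) σ⟩

/-! ### Formal square roots. -/

open MvPowerSeries

theorem constantCoeff_ofNat (k : ℕ) [k.AtLeastTwo] :
    constantCoeff (OfNat.ofNat k : MvPowerSeries (Fin 2) ℚ) = OfNat.ofNat k :=
  map_ofNat _ k

/-- Existence: substitute `F - 1` into the binomial series of exponent 1/2. Uniqueness: the ring is
a domain, and the sum of two such roots has constant term 2. -/
theorem existsUnique_isFormalSqrt {F : MvPowerSeries (Fin 2) ℚ} (hF : constantCoeff F = 1) :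
    ∃! S, IsFormalSqrt F S := by
  refine existsUnique_of_exists_of_unique ?_ ?_
  · have hs : PowerSeries.HasSubst (F - 1) :=
      PowerSeries.HasSubst.of_constantCoeff_zero (by simp [hF])
    let B : PowerSeries ℚ := PowerSeries.binomialSeries ℚ (1 / 2 : ℚ)
    have hB : B * B = 1 + PowerSeries.X := by
      rw [← PowerSeries.binomialSeries_add]
      have := PowerSeries.binomialSeries_nat (R := ℚ) (A := ℚ) 1
      rw [pow_one] at this
      rw [← this]
      norm_num
    have hsq : (B.subst (F - 1)) ^ 2 = F := by
      rw [sq, ← PowerSeries.subst_mul hs, hB, PowerSeries.subst_add hs, PowerSeries.subst_X hs]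
      have : (1 : PowerSeries ℚ).subst (F - 1) = 1 := by
        rw [← PowerSeries.coe_substAlgHom hs, map_one]
      rw [this]
      ring
    have hcc : constantCoeff (B.subst (F - 1)) = 1 := by
      have h₁ : B = 1 + (B - 1) := by ring
      have h₂ : PowerSeries.constantCoeff (B - 1) = 0 := by
        simp [B]
      have h₃ := PowerSeries.constantCoeff_subst_eq_zero (a := F - 1) (by simp [hF]) (B - 1) h₂
      rw [h₁, PowerSeries.subst_add hs, map_add, h₃, ← PowerSeries.coe_substAlgHom hs, map_one]
      simp
    exact ⟨_, hsq, hcc⟩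
  · rintro S T ⟨hS, hS'⟩ ⟨hT, hT'⟩
    have h : (S - T) * (S + T) = 0 := by
      linear_combination hS - hT
    rcases mul_eq_zero.1 h with h | h
    · exact sub_eq_zero.1 h
    · have := congrArg constantCoeff h
      rw [map_add, hS', hT', map_zero] at this
      norm_num at this

/-! ### Supports of power series under an additive weight. -/

/-- All monomials of `f` have nonpositive weight with respect to `w`. -/
def SupportedBy (w : (Fin 2 →₀ ℕ) →+ ℤ) (f : MvPowerSeries (Fin 2) ℚ) : Prop :=
  ∀ d, 0 < w d → coeff d f = 0

namespace SupportedBy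

variable {w : (Fin 2 →₀ ℕ) →+ ℤ} {f h : MvPowerSeries (Fin 2) ℚ}

theorem add (hf : SupportedBy w f) (hh : SupportedBy w h) : SupportedBy w (f + h) :=
  fun d hd => by rw [map_add, hf d hd, hh d hd, add_zero]

theorem sub (hf : SupportedBy w f) (hh : SupportedBy w h) : SupportedBy w (f - h) :=
  fun d hd => by rw [map_sub, hf d hd, hh d hd, sub_zero]

theorem mul (hf : SupportedBy w f) (hh : SupportedBy w h) : SupportedBy w (f * h) := by
  intro d hd
  rw [coeff_mul]
  refine Finset.sum_eq_zero fun e he => ?_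
  rw [Finset.HasAntidiagonal.mem_antidiagonal] at he
  rw [← he, map_add] at hd
  rcases lt_or_ge 0 (w e.1) with h₁ | h₁
  · rw [hf _ h₁, zero_mul]
  · rw [hh e.2 (by omega), mul_zero]

theorem C (r : ℚ) : SupportedBy w (MvPowerSeries.C r) := by
  intro d hd
  rw [coeff_C_of_ne_zero]
  rintro rfl
  simp at hd

theorem one : SupportedBy w 1 := C 1

theorem ofNat (k : ℕ) [k.AtLeastTwo] : SupportedBy w (OfNat.ofNat k) := by
  have : (OfNat.ofNat k : MvPowerSeries (Fin 2) ℚ) = MvPowerSeries.C (OfNat.ofNat k) :=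
    (map_ofNat MvPowerSeries.C k).symm
  rw [this]
  exact C _

theorem X {s : Fin 2} (hs : w (Finsupp.single s 1) ≤ 0) : SupportedBy w (MvPowerSeries.X s) := by
  intro d hd
  rw [coeff_X, if_neg]
  rintro rfl
  omega

/-- If `f` and `f * h` are supported on nonpositive weights and `f` is invertible, then `h` is
supported on nonpositive weights too. -/
theorem of_mul_eq (hf : SupportedBy w f) (hc : constantCoeff f ≠ 0) (hfh : SupportedBy w (f * h)) :
    SupportedBy w h := by
  intro d
  induction d using WellFoundedLT.induction with
  | ind d ih =>
    intro hd
    have h₀ := hfh d hd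
    rw [coeff_mul, Finset.sum_eq_single (0, d)] at h₀
    · exact (mul_eq_zero.1 h₀).resolve_left hc
    · rintro ⟨e₁, e₂⟩ he hne
      rw [Finset.HasAntidiagonal.mem_antidiagonal] at he
      dsimp only at he ⊢
      rcases lt_or_ge 0 (w e₁) with h₁ | h₁
      · rw [hf _ h₁, zero_mul]
      · have hw : w d = w e₁ + w e₂ := by rw [← he, map_add]
        have he₁ : e₁ ≠ 0 := by
          rintro rfl
          exact hne (by rw [← he, zero_add])
        rw [ih e₂ ?_ (by omega), mul_zero]
        rw [← he]
        exact lt_add_of_pos_left _ (pos_iff_ne_zero.2 he₁)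
    · intro hn
      exact absurd (Finset.HasAntidiagonal.mem_antidiagonal.2 (zero_add d)) hn

/-- The coefficient of `f ^ 2` at `d` is twice the constant term of `f` times its coefficient at
`d`, plus products over proper splittings of `d`; in each of these one part has positive weight, so
induction applies. -/
theorem of_sq (hc : constantCoeff f ≠ 0) (hf : SupportedBy w (f ^ 2)) : SupportedBy w f := by
  intro d
  induction d using WellFoundedLT.induction with
  | ind d ih =>
    intro hd
    have hd0 : d ≠ 0 := by
      rintro rfl
      simp at hd
    have h₀ := hf d hd
    rw [sq, coeff_mul, Finset.sum_eq_add (0, d) (d, 0) (fun h => hd0 (congrArg Prod.snd h))] at h₀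
    · dsimp only at h₀
      rw [coeff_zero_eq_constantCoeff_apply, mul_comm (coeff d f), ← two_mul] at h₀
      simpa [hc] using h₀
    · rintro ⟨e₁, e₂⟩ he ⟨hne₁, hne₂⟩
      rw [Finset.HasAntidiagonal.mem_antidiagonal] at he
      dsimp only at he ⊢
      have hw : w d = w e₁ + w e₂ := by rw [← he, map_add]
      have he₁ : e₁ ≠ 0 := by
        rintro rfl
        exact hne₁ (by rw [← he, zero_add])
      have he₂ : e₂ ≠ 0 := by
        rintro rfl
        exact hne₂ (by rw [← he, add_zero])
      rcases lt_or_ge 0 (w e₁) with h₁ | h₁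
      · rw [ih e₁ ?_ h₁, zero_mul]
        rw [← he]
        exact lt_add_of_pos_right _ (pos_iff_ne_zero.2 he₂)
      · rw [ih e₂ ?_ (by omega), mul_zero]
        rw [← he]
        exact lt_add_of_pos_left _ (pos_iff_ne_zero.2 he₁)
    · intro hn
      exact absurd (Finset.HasAntidiagonal.mem_antidiagonal.2 (zero_add d)) hn
    · intro hn
      exact absurd (Finset.HasAntidiagonal.mem_antidiagonal.2 (add_zero d)) hn

end SupportedBy

/-! ### Coefficients and the triangle of numbers. -/

/-- The exponent of the monomial `x ^ n * u ^ l`. -/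
noncomputable def expo (n l : ℕ) : Fin 2 →₀ ℕ :=
  Finsupp.single 0 n + Finsupp.single 1 l

@[simp] theorem expo_zero (n l : ℕ) : expo n l 0 = n := by simp [expo]

@[simp] theorem expo_one (n l : ℕ) : expo n l 1 = l := by simp [expo]

theorem expo_self (d : Fin 2 →₀ ℕ) : expo (d 0) (d 1) = d := by
  ext s
  fin_cases s <;> simp

theorem expo_zero_zero : expo 0 0 = 0 := by simp [expo]

theorem expo_eq_zero_iff {n l : ℕ} : expo n l = 0 ↔ n = 0 ∧ l = 0 := by
  constructor
  · intro h
    have h₀ := DFunLike.congr_fun h 0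
    have h₁ := DFunLike.congr_fun h 1
    simpa using And.intro h₀ h₁
  · rintro ⟨rfl, rfl⟩
    exact expo_zero_zero

theorem coeff_x_mul (n l : ℕ) (f : MvPowerSeries (Fin 2) ℚ) :
    coeff (expo (n + 1) l) (x * f) = coeff (expo n l) f := by
  have h : expo (n + 1) l = Finsupp.single 0 1 + expo n l := by
    rw [expo, expo, ← add_assoc, ← Finsupp.single_add, add_comm 1 n]
  rw [h, x, X_def, coeff_add_monomial_mul, one_mul]

theorem coeff_u_mul (n l : ℕ) (f : MvPowerSeries (Fin 2) ℚ) :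
    coeff (expo n (l + 1)) (u * f) = coeff (expo n l) f := by
  have h : expo n (l + 1) = Finsupp.single 1 1 + expo n l := by
    rw [expo, expo, add_left_comm, ← Finsupp.single_add, add_comm 1 l]
  rw [h, u, X_def, coeff_add_monomial_mul, one_mul]

theorem coeff_zero_x_mul (l : ℕ) (f : MvPowerSeries (Fin 2) ℚ) :
    coeff (expo 0 l) (x * f) = 0 := by
  rw [x, X_def, coeff_monomial_mul, if_neg]
  intro h
  simpa using h 0

theorem coeff_zero_u_mul (n : ℕ) (f : MvPowerSeries (Fin 2) ℚ) :
    coeff (expo n 0) (u * f) = 0 := by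
  rw [u, X_def, coeff_monomial_mul, if_neg]
  intro h
  simpa using h 1

/-- The recurrence satisfied by the numbers `a n l`, with the sum removed by taking differences,
together with its boundary conditions. -/
structure IsTriangle (f : ℕ → ℕ → ℚ) : Prop where
  zero_right : ∀ n, f n 0 = 0
  zero_left : ∀ l, f 0 l = 0
  one_one : f 1 1 = 1
  two_one : f 2 1 = 1
  one_add_two : ∀ l, f 1 (l + 2) = 0
  of_le : ∀ n l, 2 ≤ n → n ≤ l → f n l = 0
  succ_succ : ∀ n l, 2 ≤ n → l < n →
    f (n + 1) (l + 1) = f (n + 1) l - f n l + 2 * f n (l + 1)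

/-- Induction on the column `l`, and within a column on `n`. -/
theorem IsTriangle.unique {f f' : ℕ → ℕ → ℚ} (hf : IsTriangle f) (hf' : IsTriangle f') (n l : ℕ) :
    f n l = f' n l := by
  induction l generalizing n with
  | zero => rw [hf.zero_right, hf'.zero_right]
  | succ l ihl =>
    induction n with
    | zero => rw [hf.zero_left, hf'.zero_left]
    | succ n ihn =>
      rcases Nat.lt_or_ge n 2 with hn | hn
      · interval_cases n
        · rcases l with _ | l
          · rw [zero_add, hf.one_one, hf'.one_one]
          · rw [zero_add, hf.one_add_two, hf'.one_add_two]
        · rcases l with _ | l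
          · rw [zero_add, one_add_one_eq_two, hf.two_one, hf'.two_one]
          · rw [hf.of_le _ _ (by omega) (by omega), hf'.of_le _ _ (by omega) (by omega)]
      · rcases Nat.lt_or_ge l n with hl | hl
        · rw [hf.succ_succ n l hn hl, hf'.succ_succ n l hn hl, ihl, ihl, ihn]
        · rw [hf.of_le _ _ (by omega) (by omega), hf'.of_le _ _ (by omega) (by omega)]

theorem isTriangle_a : IsTriangle fun n l => (a n l : ℚ) where
  zero_right n := by rw [a_eq_zero (by omega), Nat.cast_zero]
  zero_left l := by rw [a_eq_zero (by omega), Nat.cast_zero]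
  one_one := by rw [a_one_one, Nat.cast_one]
  two_one := by rw [a_two_one, Nat.cast_one]
  one_add_two l := by rw [a_eq_zero (by omega), Nat.cast_zero]
  of_le n l hn hl := by
    rcases hl.eq_or_lt with rfl | hl
    · rw [a_self hn, Nat.cast_zero]
    · rw [a_eq_zero (by omega), Nat.cast_zero]
  succ_succ n l hn hl := by
    rcases l with _ | l
    · rw [a_succ hn hl, a_eq_zero (n := n + 1) (by omega), a_eq_zero (ℓ := 0) (by omega)]
      simp
    · rw [a_succ hn hl, a_succ hn (by omega), Finset.sum_Icc_succ_top (by omega)]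
      push_cast
      ring

theorem coeff_g (n l : ℕ) : coeff (expo n l) g = a n l := by
  rw [coeff_apply]
  unfold g
  rw [expo_zero, expo_one]
  split_ifs with h
  · rfl
  · rw [a_eq_zero h, Nat.cast_zero]

/-- The degree in `u` minus the degree in `x`. -/
def excess : (Fin 2 →₀ ℕ) →+ ℤ where
  toFun d := (d 1 : ℤ) - d 0
  map_zero' := by simp
  map_add' d e := by
    simp only [Finsupp.add_apply]
    push_cast
    ring

theorem excess_expo (n l : ℕ) : excess (expo n l) = (l : ℤ) - n := by
  simp [excess]

theorem excess_single_zero : excess (Finsupp.single 0 1) = -1 := by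
  simp [excess]

theorem excess_single_one : excess (Finsupp.single 1 1) = 1 := by
  simp [excess]

theorem supportedBy_excess_x : SupportedBy excess x :=
  SupportedBy.X (by rw [excess_single_zero]; norm_num)

theorem supportedBy_neg_excess_u : SupportedBy (-excess) u :=
  SupportedBy.X (by rw [AddMonoidHom.neg_apply, excess_single_one]; norm_num)

theorem supportedBy_u_mul_x {w : (Fin 2 →₀ ℕ) →+ ℤ} (hw : w = excess ∨ w = -excess) :
    SupportedBy w (u * x) := by
  intro d hd
  have h : u * x = monomial (Finsupp.single 1 1 + Finsupp.single 0 1) (1 : ℚ) := by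
    rw [u, x, X_def, X_def, monomial_mul_monomial, one_mul]
  rw [h]
  refine coeff_monomial_ne ?_ _
  rintro rfl
  rw [map_add] at hd
  rcases hw with rfl | rfl
  · rw [excess_single_zero, excess_single_one] at hd
    omega
  · rw [AddMonoidHom.neg_apply, AddMonoidHom.neg_apply, excess_single_zero,
      excess_single_one] at hd
    omega

/-! ### The closed form. -/

section Sqrt

variable {S : MvPowerSeries (Fin 2) ℚ}

theorem constantCoeff_x : constantCoeff x = (0 : ℚ) := constantCoeff_X 0

/-- Used with both signs of the weight, this says that `S` is a series in the product `u * x` alone.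
-/
theorem supportedBy_sqrt (hS : IsFormalSqrt (1 - 6 * u * x + u ^ 2 * x ^ 2) S)
    {w : (Fin 2 →₀ ℕ) →+ ℤ} (hw : w = excess ∨ w = -excess) : SupportedBy w S := by
  have hux := supportedBy_u_mul_x hw
  refine SupportedBy.of_sq (by rw [hS.2]; exact one_ne_zero) ?_
  have h : S ^ 2 = 1 - 6 * (u * x) + (u * x) * (u * x) := by
    rw [hS.1]
    ring
  rw [h]
  exact (SupportedBy.one.sub ((SupportedBy.ofNat 6).mul hux)).add (hux.mul hux)

theorem isTriangle_closedForm (hS : IsFormalSqrt (1 - 6 * u * x + u ^ 2 * x ^ 2) S) :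
    ∃ H : MvPowerSeries (Fin 2) ℚ, IsTriangle (fun n l => coeff (expo n l) H) ∧
      4 * (u - 1 - u * x + 2 * x) * H = u * x * (4 * u - 3 + 4 * x - 3 * u * x - S) := by
  set q : MvPowerSeries (Fin 2) ℚ := C (1 / 4 : ℚ) with hq
  have h4q : 4 * q = 1 := by
    have h4 : (4 : MvPowerSeries (Fin 2) ℚ) = C (4 : ℚ) := (map_ofNat C 4).symm
    rw [h4, hq, ← map_mul]
    norm_num
  set G := q * (1 + u * x - S) with hG
  -- `M` is the cofactor in `P(x) - P(G) = (G - x) * M`, where `P(t) = 2 * t ^ 2 - (1 + u * x) * t +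
  -- u * x`.
  set M := 1 + u * x - 2 * G - 2 * x with hM
  have hG0 : constantCoeff G = 0 := by
    rw [hG, map_mul, map_sub, hS.2]
    simp [constantCoeff_x]
  have hM1 : constantCoeff M = 1 := by
    simp [hM, hG0, constantCoeff_x]
  have hMV : M * M⁻¹ = 1 := MvPowerSeries.mul_inv_cancel _ (by rw [hM1]; exact one_ne_zero)
  set V := M⁻¹ with hV
  have hGq : 2 * G ^ 2 - (1 + u * x) * G + u * x = 0 := by
    have h₁ := hS.1
    have h₂ : 4 * G = 1 + u * x - S := by
      rw [hG, ← mul_assoc, h4q, one_mul]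
    have h₃ : 8 * (2 * G ^ 2 - (1 + u * x) * G + u * x) = 0 := by
      linear_combination (4 * G - (1 + u * x) - S) * h₂ + h₁
    refine (mul_eq_zero.1 h₃).resolve_left fun h8 => ?_
    have := congrArg constantCoeff h8
    rw [constantCoeff_ofNat] at this
    norm_num at this
  -- Here `P(G) = 0` and `P(x) = x * (u - 1 - u * x + 2 * x)`.
  have hGx : G - x = x * (u - 1 - u * x + 2 * x) * V := by
    have h₁ : (G - x) * M = x * (u - 1 - u * x + 2 * x) := by
      rw [hM]
      linear_combination -hGq
    rw [← h₁, mul_assoc, hMV, mul_one]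
  have hVs : SupportedBy excess V := by
    have hux := supportedBy_u_mul_x (Or.inl rfl)
    have hGs : SupportedBy excess G :=
      (SupportedBy.C _).mul ((SupportedBy.one.add hux).sub (supportedBy_sqrt hS (Or.inl rfl)))
    refine SupportedBy.of_mul_eq (f := M) ?_ (by rw [hM1]; exact one_ne_zero)
      (by rw [hMV]; exact SupportedBy.one)
    exact ((SupportedBy.one.add hux).sub ((SupportedBy.ofNat 2).mul hGs)).sub
      ((SupportedBy.ofNat 2).mul supportedBy_excess_x)
  have hV0 : coeff (expo 0 0) V = 1 := by
    rw [expo_zero_zero, coeff_zero_eq_constantCoeff_apply]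
    have := congrArg constantCoeff hMV
    rwa [map_mul, hM1, one_mul, map_one] at this
  -- This is `u * x * (K + G - x) / K`, with the division by the kernel `K` carried out through
  -- `hGx`.
  set H := u * (x * (1 + x * V)) with hH
  have hone : ∀ n l, 0 < n + l → coeff (expo n l) (1 : MvPowerSeries (Fin 2) ℚ) = 0 := by
    intro n l h
    rw [coeff_one, if_neg]
    rw [expo_eq_zero_iff]
    omega
  have hone' : coeff (expo 0 0) (1 : MvPowerSeries (Fin 2) ℚ) = 1 := by
    rw [expo_zero_zero, coeff_zero_one]
  have hKH : u * H - H - u * (x * H) + (x * H + x * H) =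
      u * (x * (u - 1 - u * x + G + x)) := by
    rw [hH]
    linear_combination -u * x * hGx
  refine ⟨H, ⟨?_, ?_, ?_, ?_, ?_, ?_, ?_⟩, ?_⟩
  · intro n
    exact coeff_zero_u_mul n _
  · intro l
    rw [hH, mul_left_comm, coeff_zero_x_mul]
  · change coeff (expo (0 + 1) (0 + 1)) H = 1
    rw [hH, coeff_u_mul, coeff_x_mul, map_add, coeff_zero_x_mul, hone', add_zero]
  · change coeff (expo (0 + 1 + 1) (0 + 1)) H = 1
    rw [hH, coeff_u_mul, coeff_x_mul, map_add, coeff_x_mul, hV0, hone _ _ (by omega), zero_add]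
  · intro l
    change coeff (expo (0 + 1) (l + 1 + 1)) H = 0
    rw [hH, coeff_u_mul, coeff_x_mul, map_add, coeff_zero_x_mul, hone _ _ (by omega), add_zero]
  · intro n l hn hl
    obtain ⟨n, rfl⟩ : ∃ k, n = k + 1 + 1 := ⟨n - 2, by omega⟩
    obtain ⟨l, rfl⟩ : ∃ k, l = k + 1 := ⟨l - 1, by omega⟩
    rw [hH, coeff_u_mul, coeff_x_mul, map_add, coeff_x_mul, hone _ _ (by omega), zero_add]
    -- Removing `u * x * x` raises the excess by one, so `n ≤ l` already gives positive weight.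
    refine hVs _ ?_
    rw [excess_expo]
    omega
  · intro n l hn hl
    have h₁ := congrArg (coeff (expo (n + 1) (l + 1))) hKH
    simp only [map_add, map_sub, coeff_u_mul, coeff_x_mul] at h₁
    have hux := supportedBy_u_mul_x (w := -excess) (Or.inr rfl)
    -- Below the diagonal the right side of `hKH`, stripped of `u * x`, can only contribute the
    -- monomial `x`, and `2 ≤ n` excludes it.
    have hs : SupportedBy (-excess) (u - 1 - u * x + G) :=
      ((supportedBy_neg_excess_u.sub SupportedBy.one).sub hux).add
        ((SupportedBy.C _).mul ((SupportedBy.one.add hux).sub (supportedBy_sqrt hS (Or.inr rfl))))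
    have h₂ := hs (expo n l) (by rw [AddMonoidHom.neg_apply, excess_expo]; omega)
    have h₃ : coeff (expo n l) x = 0 := by
      rw [x, coeff_X, if_neg]
      intro h
      have := DFunLike.congr_fun h 0
      simp at this
      omega
    simp only [map_add, map_sub] at h₂
    rw [h₂, h₃] at h₁
    linear_combination -h₁
  · have h₂ : 4 * G = 1 + u * x - S := by
      rw [hG, ← mul_assoc, h4q, one_mul]
    linear_combination 4 * hKH + u * x * h₂

end Sqrt

end SkewAvoid

theorem mainTheorem4 :
    a 1 1 = 1 ∧ a 2 1 = 1 ∧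
    (∀ n ℓ : ℕ, 3 ≤ n → 1 ≤ ℓ → ℓ ≤ n - 1 →
      a n ℓ = 2 * a (n - 1) ℓ + ∑ j ∈ Finset.Icc 1 (ℓ - 1), a (n - 1) j) ∧
    (∃! S : MvPowerSeries (Fin 2) ℚ,
      IsFormalSqrt (1 - 6 * u * x + u ^ 2 * x ^ 2) S) ∧
    (∀ S : MvPowerSeries (Fin 2) ℚ,
      IsFormalSqrt (1 - 6 * u * x + u ^ 2 * x ^ 2) S →
      g = (u * x * (4 * u - 3 + 4 * x - 3 * u * x - S)) *
          (4 * (u - 1 - u * x + 2 * x))⁻¹) := by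
  refine ⟨a_one_one, a_two_one, ?_, ?_, ?_⟩
  · intro n ℓ hn hℓ hℓn
    obtain ⟨n, rfl⟩ : ∃ k, n = k + 1 := ⟨n - 1, by omega⟩
    obtain ⟨z, rfl⟩ : ∃ k, ℓ = k + 1 := ⟨ℓ - 1, by omega⟩
    exact a_succ (by omega) (by omega)
  · refine existsUnique_isFormalSqrt ?_
    simp [constantCoeff_x]
  · intro S hS
    obtain ⟨H, hH, hKH⟩ := isTriangle_closedForm hS
    have hg : g = H := by
      refine MvPowerSeries.ext fun d => ?_
      rw [← expo_self d, coeff_g]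
      exact isTriangle_a.unique hH _ _
    rw [hg, ← hKH, mul_right_comm, denominator_mul_inv, one_mul]
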